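/- Let $\Bbbk$ be a field of characteristic zero, $G$ an abelian group with a symmetric $\mathbb Z$-bilinear map $G\times G\to\mathbb Z_2$, $(g,h)\mapsto g\cdot h$, and let $A$ be a unital, associative, $G$-graded $\Bbbk$-algebra that is graded-commutative: $ab=(-1)^{|a|\cdot|b|}ba$ for homogeneous $a,b$. Let $\Lambda(A)$ be the algebra of differential forms over $A$, i.e. the graded exterior algebra over $A$ of the module $\Lambda^1(A)$ generated by symbols $da$ ($a\in A$), $\Bbbk$-linear in $a$, with $d(ab)=da\cdot b+a\,db$ and $da\cdot b=(-1)^{|a|\cdot|b|}b\,da$ for homogeneous $a,b$; thus also $da\wedge db=-(-1)^{|a|\cdot|b|}db\wedge da$. It is $G\oplus\mathbb Z$-graded, with $|a|=(g,0)$ and $|da|=(g,1)$ for $a$ homogeneous of degree $g$, and graded-commutative with respect to $(g,p)\cdot(h,q)=g\cdot h+[pq]_2$. Its exterior differential $d$ is the graded derivation of degree $(0,1)$ with $a\mapsto da$, $da\mapsto 0$. For a homogeneous graded derivation $X$ of $A$, $i_X$ denotes the graded derivation of $\Lambda(A)$ of degree $(|X|,-1)$ with $a\mapsto 0$, $da\mapsto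 X(a)$, and $\mathcal L_X=[i_X,d]$ (graded commutator) extends $X$ to $\Lambda(A)$. Put $\Lambda_1=\Lambda(A)$ and $\Lambda_2=\Lambda(\Lambda_1)$, a $G\oplus\mathbb Z^2$-graded algebra with homogeneous components $\Lambda_2^{(g,p,q)}$. Let $d_2$ be the exterior differential of $\Lambda_2=\Lambda(\Lambda_1)$ and let $d_1$ be the extension $\mathcal L_{d}$ to $\Lambda_2$ of the exterior differential $d$ of $\Lambda_1$. Then $(\Lambda_2,d_1,d_2)$ is a double complex: $d_1$ and $d_2$ map $\Lambda_2^{(g,p,q)}$ into $\Lambda_2^{(g,p+1,q)}$ and $\Lambda_2^{(g,p,q+1)}$ respectively, $d_1^2=d_2^2=0$ and $d_1d_2=d_2d_1$. Moreover, there is an isomorphism $\kappa_{(12)}$ of the double complexes $(\Lambda_2,d_1,d_2)$ and $(\Lambda_2,d_2,d_1)$; that is, there is a $\Bbbk$-algebra automorphism $\kappa=\kappa_{(12)}$ of $\Lambda_2$ such that $$\kappa\circ d_1=d_2\circ\kappa,\qquad \kappa\circ d_2=d_1\circ\kappa,\qquad \kappa(\Lambda_2^{(g,p,q)})\subset\Lambda_2^{(g,q,p)}.$$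 In addition, $\kappa$ is an involution ($\kappa\circ\kappa=\mathrm{id}$), it is the identity on $A$, and for all $g,\ell\in A$ one has $\kappa(d_1g)=d_2g$, $\kappa(d_2g)=d_1g$ and $\kappa(d_1d_2\ell)=d_1d_2\ell$. More generally, $$\kappa(d_1g_1\wedge\cdots\wedge d_1g_m\wedge d_2h_1\wedge\cdots\wedge d_2h_n\wedge d_1d_2\ell_1\wedge\cdots\wedge d_1d_2\ell_r)=d_2g_1\wedge\cdots\wedge d_2g_m\wedge d_1h_1\wedge\cdots\wedge d_1h_n\wedge d_1d_2\ell_1\wedge\cdots\wedge d_1d_2\ell_r$$ for all $g_i,h_i,\ell_i\in A$. -/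

import Mathlib

open scoped DirectSum

noncomputable section

namespace IteratedForms

set_option linter.unusedSectionVars false

universe u v w

/-- A symmetric `ℤ`-bilinear map `G × G → ℤ/2`; together with `G` it is a grading group. -/
structure GradingPairing (G : Type v) [AddCommGroup G] where
  toHom : G →+ G →+ ZMod 2
  symm : ∀ g h, toHom g h = toHom h g

namespace GradingPairing

variable {G : Type v} [AddCommGroup G] (P : GradingPairing G)

/-- The sign `(-1) ^ (g · h)`, as an element of the ground field. -/
def sign (k : Type u) [Field k] (g h : G) : k := (((-1 : ℤˣ) ^ (P.toHom g h) : ℤˣ) : ℤ)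

/-- The pairing `(g, k) · (h, l) = g · h + [k l]₂` on `G ⊕ ℤ`. -/
def extend : GradingPairing (G × ℤ) where
  toHom := AddMonoidHom.mk'
    (fun x => AddMonoidHom.mk' (fun y => P.toHom x.1 y.1 + ((x.2 * y.2 : ℤ) : ZMod 2))
      (fun y z => by simp [mul_add]; ring))
    (fun x y => by ext z; simp [add_mul]; ring)
  symm x y := by simp [P.symm x.1 y.1, mul_comm]

theorem extend_apply (x y : G × ℤ) :
    P.extend.toHom x y = P.toHom x.1 y.1 + ((x.2 * y.2 : ℤ) : ZMod 2) := rfl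

variable {k : Type u} [Field k]

theorem sign_eq_or (g h : G) : P.sign k g h = 1 ∨ P.sign k g h = -1 := by
  rcases Int.units_eq_one_or ((-1 : ℤˣ) ^ (P.toHom g h)) with e | e <;> simp [sign, e]

theorem sign_comm (g h : G) : P.sign k g h = P.sign k h g := by
  simp [sign, P.symm g h]

theorem sign_add_right (g h l : G) : P.sign k g (h + l) = P.sign k g h * P.sign k g l := by
  simp [sign, uzpow_add]

theorem sign_add_left (g h l : G) : P.sign k (g + h) l = P.sign k g l * P.sign k h l := by
  simp [sign, uzpow_add]

@[simp] theorem sign_zero_right (g : G) : P.sign k g 0 = 1 := by simp [sign]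

@[simp] theorem sign_zero_left (g : G) : P.sign k 0 g = 1 := by simp [sign]

@[simp] theorem sign_mul_self (g h : G) : P.sign k g h * P.sign k g h = 1 := by
  rcases P.sign_eq_or (k := k) g h with e | e <;> simp [e]

theorem sign_extend (x y : G × ℤ) : P.extend.sign k x y =
    P.sign k x.1 y.1 * (((-1 : ℤˣ) ^ (((x.2 * y.2 : ℤ)) : ZMod 2) : ℤˣ) : ℤ) := by
  simp only [sign, extend_apply, uzpow_add, Units.val_mul, Int.cast_mul]

theorem sign_extend_zero_right (g h : G) (n : ℤ) :
    P.extend.sign k (g, n) (h, 0) = P.sign k g h := by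
  simp [sign_extend]

theorem sign_extend_zero_left (g h : G) (n : ℤ) :
    P.extend.sign k (g, 0) (h, n) = P.sign k g h := by
  simp [sign_extend]

theorem sign_extend_one (g h : G) : P.extend.sign k (g, 1) (h, 1) = -P.sign k g h := by
  simp [sign_extend]

theorem sign_extend_neg_one (g h : G) : P.extend.sign k (g, -1) (h, 1) = -P.sign k g h := by
  simp [sign_extend]

end GradingPairing

variable {k : Type u} [Field k] {G : Type v} [AddCommGroup G] [DecidableEq G]
  {A : Type w} [Ring A] [Algebra k A]

/-- Graded commutativity: `a b = (-1) ^ (|a| · |b|) b a` for homogeneous `a`, `b`. -/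
class GradedCommutative (P : GradingPairing G) (𝒜 : G → Submodule k A) : Prop where
  comm : ∀ {g h : G} {a b : A}, a ∈ 𝒜 g → b ∈ 𝒜 h → a * b = P.sign k g h • (b * a)

/-- Graded derivations of degree `δ` of a graded algebra (with values in the algebra). -/
structure GradedDerivation (P : GradingPairing G) (𝒜 : G → Submodule k A) (δ : G) where
  toLinearMap : A →ₗ[k] A
  map_mem : ∀ {g : G} {a : A}, a ∈ 𝒜 g → toLinearMap a ∈ 𝒜 (g + δ)
  leibniz : ∀ {g : G} {a : A} (b : A), a ∈ 𝒜 g →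
    toLinearMap (a * b) = toLinearMap a * b + P.sign k δ g • (a * toLinearMap b)

instance (P : GradingPairing G) (𝒜 : G → Submodule k A) (δ : G) :
    CoeFun (GradedDerivation P 𝒜 δ) (fun _ => A → A) := ⟨fun X => X.toLinearMap⟩

/-- The graded commutator `[X, Y] = X Y - (-1) ^ (|X| · |Y|) Y X`. -/
def GradedDerivation.bracket {P : GradingPairing G} {𝒜 : G → Submodule k A} {δ ε : G}
    (X : GradedDerivation P 𝒜 δ) (Y : GradedDerivation P 𝒜 ε) :
    GradedDerivation P 𝒜 (δ + ε) where
  toLinearMap := X.toLinearMap ∘ₗ Y.toLinearMap - P.sign k δ ε • (Y.toLinearMap ∘ₗ X.toLinearMap)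
  map_mem {g a} ha := by
    refine Submodule.sub_mem _ ?_ (Submodule.smul_mem _ _ ?_)
    · have := X.map_mem (Y.map_mem ha)
      rwa [add_assoc, add_comm ε δ] at this
    · have := Y.map_mem (X.map_mem ha)
      rwa [add_assoc] at this
  leibniz {g a} b ha := by
    simp only [LinearMap.sub_apply, LinearMap.comp_apply, LinearMap.smul_apply]
    rw [X.leibniz b ha, Y.leibniz b ha, map_add, map_add, map_smul, map_smul,
      X.leibniz b (Y.map_mem ha), Y.leibniz b (X.map_mem ha), X.leibniz _ ha, Y.leibniz _ ha]
    simp only [P.sign_add_left, P.sign_add_right, P.sign_comm ε δ]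
    rcases P.sign_eq_or (k := k) δ g with e₁ | e₁ <;>
    rcases P.sign_eq_or (k := k) ε g with e₂ | e₂ <;>
    rcases P.sign_eq_or (k := k) δ ε with e₃ | e₃ <;>
    simp [e₁, e₂, e₃, sub_mul, mul_sub, add_mul, mul_add] <;> abel

/-! ### The algebra of differential forms -/

/-- The defining relations of the algebra of differential forms over `A`. The generator `(a, 0)`
stands for `a` and the generator `(0, a)` for its differential `d a`. -/
inductive FormsRel (P : GradingPairing G) (𝒜 : G → Submodule k A) :
    TensorAlgebra k (A × A) → TensorAlgebra k (A × A) → Prop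
  | one : FormsRel P 𝒜 (TensorAlgebra.ι k (1, 0)) 1
  | mul (a b : A) : FormsRel P 𝒜 (TensorAlgebra.ι k (a * b, 0))
      (TensorAlgebra.ι k (a, 0) * TensorAlgebra.ι k (b, 0))
  | leibniz (a b : A) : FormsRel P 𝒜 (TensorAlgebra.ι k (0, a * b))
      (TensorAlgebra.ι k (0, a) * TensorAlgebra.ι k (b, 0) +
        TensorAlgebra.ι k (a, 0) * TensorAlgebra.ι k (0, b))
  | comm_incl {g h : G} {a b : A} (ha : a ∈ 𝒜 g) (hb : b ∈ 𝒜 h) :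
      FormsRel P 𝒜 (TensorAlgebra.ι k (0, a) * TensorAlgebra.ι k (b, 0))
        (P.sign k g h • (TensorAlgebra.ι k (b, 0) * TensorAlgebra.ι k (0, a)))
  | comm_d {g h : G} {a b : A} (ha : a ∈ 𝒜 g) (hb : b ∈ 𝒜 h) :
      FormsRel P 𝒜 (TensorAlgebra.ι k (0, a) * TensorAlgebra.ι k (0, b))
        (-(P.sign k g h • (TensorAlgebra.ι k (0, b) * TensorAlgebra.ι k (0, a))))

/-- The algebra `Λ(A)` of differential forms over the graded algebra `A`: the graded exterior
algebra of the module `Λ¹(A)` generated by the differentials `d a`, subject to `k`-linearity and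
the Leibniz rule. The wedge product is written `*`. -/
def Forms (P : GradingPairing G) (𝒜 : G → Submodule k A) : Type _ := RingQuot (FormsRel P 𝒜)

namespace Forms

variable (P : GradingPairing G) (𝒜 : G → Submodule k A)

instance : Ring (Forms P 𝒜) := inferInstanceAs (Ring (RingQuot (FormsRel P 𝒜)))

instance : Algebra k (Forms P 𝒜) := inferInstanceAs (Algebra k (RingQuot (FormsRel P 𝒜)))

/-- The quotient map from the free algebra on the generators. -/
def mk : TensorAlgebra k (A × A) →ₐ[k] Forms P 𝒜 := RingQuot.mkAlgHom k (FormsRel P 𝒜)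

theorem mk_rel {x y : TensorAlgebra k (A × A)} (h : FormsRel P 𝒜 x y) :
    mk P 𝒜 x = mk P 𝒜 y := RingQuot.mkAlgHom_rel k h

/-- The inclusion `A = Λ⁰(A) ⊂ Λ(A)`. -/
def incl : A →ₐ[k] Forms P 𝒜 :=
  AlgHom.ofLinearMap
    ((mk P 𝒜).toLinearMap ∘ₗ TensorAlgebra.ι k ∘ₗ LinearMap.inl k A A)
    (by simpa using mk_rel P 𝒜 FormsRel.one)
    (fun a b => by simpa using mk_rel P 𝒜 (FormsRel.mul a b))

/-- The universal derivation `d : A → Λ¹(A) ⊂ Λ(A)`. -/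
def diff : A →ₗ[k] Forms P 𝒜 :=
  (mk P 𝒜).toLinearMap ∘ₗ TensorAlgebra.ι k ∘ₗ LinearMap.inr k A A

theorem incl_eq (a : A) : incl P 𝒜 a = mk P 𝒜 (TensorAlgebra.ι k (a, 0)) := rfl

theorem diff_eq (a : A) : diff P 𝒜 a = mk P 𝒜 (TensorAlgebra.ι k (0, a)) := rfl

theorem diff_mul (a b : A) :
    diff P 𝒜 (a * b) = diff P 𝒜 a * incl P 𝒜 b + incl P 𝒜 a * diff P 𝒜 b := by
  simpa [incl_eq, diff_eq] using mk_rel P 𝒜 (FormsRel.leibniz a b)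

variable {P 𝒜}

theorem diff_mul_incl {g h : G} {a b : A} (ha : a ∈ 𝒜 g) (hb : b ∈ 𝒜 h) :
    diff P 𝒜 a * incl P 𝒜 b = P.sign k g h • (incl P 𝒜 b * diff P 𝒜 a) := by
  have := mk_rel P 𝒜 (FormsRel.comm_incl ha hb)
  rw [map_mul, map_smul, map_mul] at this
  simpa [incl_eq, diff_eq] using this

theorem diff_mul_diff {g h : G} {a b : A} (ha : a ∈ 𝒜 g) (hb : b ∈ 𝒜 h) :
    diff P 𝒜 a * diff P 𝒜 b = -(P.sign k g h • (diff P 𝒜 b * diff P 𝒜 a)) := by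
  have := mk_rel P 𝒜 (FormsRel.comm_d ha hb)
  rw [map_mul, map_neg, map_smul, map_mul] at this
  simpa [incl_eq, diff_eq] using this

/-- The universal property of `Λ(A)`. -/
def lift {B : Type*} [Ring B] [Algebra k B] (f e : A →ₗ[k] B) (h1 : f 1 = 1)
    (hmul : ∀ a b, f (a * b) = f a * f b)
    (hleib : ∀ a b, e (a * b) = e a * f b + f a * e b)
    (hcomm : ∀ (g h : G) (a b : A), a ∈ 𝒜 g → b ∈ 𝒜 h → e a * f b = P.sign k g h • (f b * e a))
    (hd : ∀ (g h : G) (a b : A), a ∈ 𝒜 g → b ∈ 𝒜 h →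
      e a * e b = -(P.sign k g h • (e b * e a))) :
    Forms P 𝒜 →ₐ[k] B :=
  RingQuot.liftAlgHom k ⟨TensorAlgebra.lift k (f.coprod e), by
    intro x y hxy
    induction hxy with
    | one => simp [h1]
    | mul a b => simp [hmul]
    | leibniz a b => simp [hleib]
    | comm_incl ha hb =>
      rw [map_mul, map_smul, map_mul]
      simpa using hcomm _ _ _ _ ha hb
    | comm_d ha hb =>
      rw [map_mul, map_neg, map_smul, map_mul]
      simpa using hd _ _ _ _ ha hb⟩

section lift

variable {B : Type*} [Ring B] [Algebra k B] (f e : A →ₗ[k] B) (h1 : f 1 = 1)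
    (hmul : ∀ a b, f (a * b) = f a * f b)
    (hleib : ∀ a b, e (a * b) = e a * f b + f a * e b)
    (hcomm : ∀ (g h : G) (a b : A), a ∈ 𝒜 g → b ∈ 𝒜 h → e a * f b = P.sign k g h • (f b * e a))
    (hd : ∀ (g h : G) (a b : A), a ∈ 𝒜 g → b ∈ 𝒜 h →
      e a * e b = -(P.sign k g h • (e b * e a)))

theorem lift_incl (a : A) : lift (P := P) f e h1 hmul hleib hcomm hd (incl P 𝒜 a) = f a := by
  refine (RingQuot.liftAlgHom_mkAlgHom_apply k _ _ _).trans ?_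
  simp

theorem lift_diff (a : A) : lift (P := P) f e h1 hmul hleib hcomm hd (diff P 𝒜 a) = e a := by
  refine (RingQuot.liftAlgHom_mkAlgHom_apply k _ _ _).trans ?_
  simp

end lift

theorem hom_ext {B : Type*} [Ring B] [Algebra k B] {φ ψ : Forms P 𝒜 →ₐ[k] B}
    (hi : ∀ a, φ (incl P 𝒜 a) = ψ (incl P 𝒜 a)) (hd : ∀ a, φ (diff P 𝒜 a) = ψ (diff P 𝒜 a)) :
    φ = ψ := by
  refine RingQuot.ringQuot_ext' (S := k) (s := FormsRel P 𝒜) φ ψ (TensorAlgebra.hom_ext ?_)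
  refine LinearMap.prod_ext ?_ ?_
  · ext a; exact hi a
  · ext a; exact hd a

/-! ### The grading of `Λ(A)` by `G ⊕ ℤ` -/

variable (P 𝒜)

/-- Products of homogeneous elements `a` of degree `(|a|, 0)` and differentials `d a` of degree
`(|a|, 1)`, with their total degree. -/
inductive IsWord : G × ℤ → Forms P 𝒜 → Prop
  | one : IsWord 0 1
  | incl_mul {g : G} {a : A} {i : G × ℤ} {x : Forms P 𝒜} :
      a ∈ 𝒜 g → IsWord i x → IsWord ((g, 0) + i) (incl P 𝒜 a * x)
  | diff_mul {g : G} {a : A} {i : G × ℤ} {x : Forms P 𝒜} :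
      a ∈ 𝒜 g → IsWord i x → IsWord ((g, 1) + i) (diff P 𝒜 a * x)

/-- The homogeneous component `Λⁿ(A)^g` of degree `(g, n)`. -/
def grading (i : G × ℤ) : Submodule k (Forms P 𝒜) := Submodule.span k {x | IsWord P 𝒜 i x}

variable {P 𝒜}

theorem word_mem {i : G × ℤ} {x : Forms P 𝒜} (h : IsWord P 𝒜 i x) : x ∈ grading P 𝒜 i :=
  Submodule.subset_span h

theorem incl_mem {g : G} {a : A} (ha : a ∈ 𝒜 g) : incl P 𝒜 a ∈ grading P 𝒜 (g, 0) := by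
  simpa using word_mem (IsWord.incl_mul (P := P) ha IsWord.one)

theorem diff_mem {g : G} {a : A} (ha : a ∈ 𝒜 g) : diff P 𝒜 a ∈ grading P 𝒜 (g, 1) := by
  simpa using word_mem (IsWord.diff_mul (P := P) ha IsWord.one)

theorem isWord_mul {i j : G × ℤ} {x y : Forms P 𝒜} (hx : IsWord P 𝒜 i x) (hy : IsWord P 𝒜 j y) :
    IsWord P 𝒜 (i + j) (x * y) := by
  induction hx with
  | one => simpa using hy
  | incl_mul ha _ ih => rw [add_assoc, mul_assoc]; exact IsWord.incl_mul ha ih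
  | diff_mul ha _ ih => rw [add_assoc, mul_assoc]; exact IsWord.diff_mul ha ih

theorem grading_induction {i : G × ℤ} {p : Forms P 𝒜 → Prop} (hw : ∀ x, IsWord P 𝒜 i x → p x)
    (h0 : p 0) (hadd : ∀ x y, p x → p y → p (x + y)) (hsmul : ∀ (c : k) x, p x → p (c • x))
    {x : Forms P 𝒜} (hx : x ∈ grading P 𝒜 i) : p x :=
  Submodule.span_induction (fun x h => hw x h) h0 (fun x y _ _ => hadd x y)
    (fun c x _ => hsmul c x) hx

instance : SetLike.GradedMonoid (grading P 𝒜) where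
  one_mem := word_mem IsWord.one
  mul_mem i j x y hx hy := by
    refine grading_induction (p := fun x => x * y ∈ grading P 𝒜 (i + j)) ?_ (by simp) ?_ ?_ hx
    · intro x hx
      refine grading_induction (p := fun y => x * y ∈ grading P 𝒜 (i + j)) ?_ (by simp) ?_ ?_ hy
      · intro y hy; exact word_mem (isWord_mul hx hy)
      · intro a b ha hb; rw [mul_add]; exact add_mem ha hb
      · intro c a ha; rw [mul_smul_comm]; exact Submodule.smul_mem _ _ ha
    · intro a b ha hb; rw [add_mul]; exact add_mem ha hb
    · intro c a ha; rw [smul_mul_assoc]; exact Submodule.smul_mem _ _ ha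

theorem of_congr {i j : G × ℤ} (hij : i = j) {x : grading P 𝒜 i} {y : grading P 𝒜 j}
    (hxy : (x : Forms P 𝒜) = y) :
    DirectSum.of (fun i => grading P 𝒜 i) i x = DirectSum.of (fun i => grading P 𝒜 i) j y := by
  subst hij
  rw [Subtype.ext hxy]

section

variable [GradedAlgebra 𝒜]

theorem homogeneous_induction {p : A → Prop} (h0 : p 0)
    (hh : ∀ (g : G) (a : A), a ∈ 𝒜 g → p a) (hadd : ∀ a b, p a → p b → p (a + b)) (a : A) : p a :=
  DirectSum.Decomposition.inductionOn 𝒜 h0 (fun m => hh _ _ m.2) hadd a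

variable (P 𝒜)

/-- The map `a ↦ ∑ φ(a_g)`, where `φ(a_g)` is placed in degree `(g, n)`. -/
def toSum (n : ℤ) (φ : A →ₗ[k] Forms P 𝒜) (hφ : ∀ g, ∀ a ∈ 𝒜 g, φ a ∈ grading P 𝒜 (g, n)) :
    A →ₗ[k] ⨁ i, grading P 𝒜 i :=
  (DirectSum.toModule k G _ (fun g =>
    DirectSum.lof k (G × ℤ) (fun i => grading P 𝒜 i) (g, n) ∘ₗ
      (φ ∘ₗ (𝒜 g).subtype).codRestrict (grading P 𝒜 (g, n)) (fun a => hφ g a a.2))) ∘ₗ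
    (DirectSum.decomposeLinearEquiv 𝒜).toLinearMap

variable {P 𝒜}

theorem toSum_apply (n : ℤ) (φ : A →ₗ[k] Forms P 𝒜)
    (hφ : ∀ g, ∀ a ∈ 𝒜 g, φ a ∈ grading P 𝒜 (g, n)) {g : G} {a : A} (ha : a ∈ 𝒜 g) :
    toSum P 𝒜 n φ hφ a = DirectSum.of (fun i => grading P 𝒜 i) (g, n) ⟨φ a, hφ g a ha⟩ := by
  simp only [toSum, LinearMap.comp_apply, LinearEquiv.coe_coe,
    DirectSum.decomposeLinearEquiv_apply, DirectSum.decompose_of_mem 𝒜 ha]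
  rw [← DirectSum.lof_eq_of k, DirectSum.toModule_lof]
  rfl

theorem smul_of (s : k) (i : G × ℤ) (x : grading P 𝒜 i) :
    s • DirectSum.of (fun i => grading P 𝒜 i) i x =
      DirectSum.of (fun i => grading P 𝒜 i) i (s • x) := by
  exact ((DirectSum.lof k (G × ℤ) (fun i => grading P 𝒜 i) i).map_smul s x).symm

variable (P 𝒜) in
/-- The map `A → ⨁ Λ(A)_i` induced by the inclusion. -/
def sumIncl : A →ₗ[k] ⨁ i, grading P 𝒜 i :=
  toSum P 𝒜 0 (incl P 𝒜).toLinearMap (fun _ _ h => incl_mem h)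

variable (P 𝒜) in
/-- The map `A → ⨁ Λ(A)_i` induced by the universal derivation. -/
def sumDiff : A →ₗ[k] ⨁ i, grading P 𝒜 i :=
  toSum P 𝒜 1 (diff P 𝒜) (fun _ _ h => diff_mem h)

theorem sumIncl_apply {g : G} {a : A} (ha : a ∈ 𝒜 g) :
    sumIncl P 𝒜 a = DirectSum.of (fun i => grading P 𝒜 i) (g, 0) ⟨incl P 𝒜 a, incl_mem ha⟩ :=
  toSum_apply _ _ _ ha

theorem sumDiff_apply {g : G} {a : A} (ha : a ∈ 𝒜 g) :
    sumDiff P 𝒜 a = DirectSum.of (fun i => grading P 𝒜 i) (g, 1) ⟨diff P 𝒜 a, diff_mem ha⟩ :=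
  toSum_apply _ _ _ ha

theorem diff_mul_incl_mem {g h : G} {a b : A} (ha : a ∈ 𝒜 g) (hb : b ∈ 𝒜 h) :
    diff P 𝒜 a * incl P 𝒜 b ∈ grading P 𝒜 (g + h, 1) := by
  simpa using SetLike.GradedMul.mul_mem (diff_mem (P := P) ha) (incl_mem (P := P) hb)

theorem incl_mul_diff_mem {g h : G} {a b : A} (ha : a ∈ 𝒜 g) (hb : b ∈ 𝒜 h) :
    incl P 𝒜 a * diff P 𝒜 b ∈ grading P 𝒜 (g + h, 1) := by
  simpa using SetLike.GradedMul.mul_mem (incl_mem (P := P) ha) (diff_mem (P := P) hb)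

theorem sumDiff_mul {g h : G} {a b : A} (ha : a ∈ 𝒜 g) (hb : b ∈ 𝒜 h) :
    sumDiff P 𝒜 (a * b) = sumDiff P 𝒜 a * sumIncl P 𝒜 b + sumIncl P 𝒜 a * sumDiff P 𝒜 b := by
  have e₁ : sumDiff P 𝒜 a * sumIncl P 𝒜 b = DirectSum.of (fun i => grading P 𝒜 i) (g + h, 1)
      ⟨diff P 𝒜 a * incl P 𝒜 b, diff_mul_incl_mem ha hb⟩ := by
    rw [sumDiff_apply ha, sumIncl_apply hb, DirectSum.of_mul_of]
    exact of_congr (by simp) rfl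
  have e₂ : sumIncl P 𝒜 a * sumDiff P 𝒜 b = DirectSum.of (fun i => grading P 𝒜 i) (g + h, 1)
      ⟨incl P 𝒜 a * diff P 𝒜 b, incl_mul_diff_mem ha hb⟩ := by
    rw [sumIncl_apply ha, sumDiff_apply hb, DirectSum.of_mul_of]
    exact of_congr (by simp) rfl
  rw [e₁, e₂, sumDiff_apply (SetLike.GradedMul.mul_mem ha hb), ← map_add]
  exact of_congr rfl (diff_mul P 𝒜 a b)

variable (P 𝒜) in
/-- The decomposition of a form into homogeneous components. -/
def toGraded : Forms P 𝒜 →ₐ[k] ⨁ i, grading P 𝒜 i :=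
  lift (P := P) (𝒜 := 𝒜) (B := ⨁ i, grading P 𝒜 i) (sumIncl P 𝒜) (sumDiff P 𝒜)
    (by
      rw [sumIncl_apply (SetLike.GradedOne.one_mem (A := 𝒜)), DirectSum.one_def]
      exact of_congr rfl (by simp))
    (by
      intro a b
      induction a using homogeneous_induction (𝒜 := 𝒜) with
      | h0 => simp
      | hadd a a' h h' => simp [add_mul, h, h']
      | hh g a ha =>
      induction b using homogeneous_induction (𝒜 := 𝒜) with
      | h0 => simp
      | hadd a a' h h' => simp [mul_add, h, h']
      | hh h b hb =>
        rw [sumIncl_apply ha, sumIncl_apply hb,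
          sumIncl_apply (SetLike.GradedMul.mul_mem ha hb), DirectSum.of_mul_of]
        exact of_congr (by simp) (by simp))
    (by
      intro a b
      induction a using homogeneous_induction (𝒜 := 𝒜) with
      | h0 => simp
      | hadd a a' h h' => simp only [add_mul, map_add, h, h']; abel
      | hh g a ha =>
      induction b using homogeneous_induction (𝒜 := 𝒜) with
      | h0 => simp
      | hadd a a' h h' => simp only [mul_add, map_add, h, h']; abel
      | hh h b hb =>
        exact sumDiff_mul ha hb)
    (by
      intro g h a b ha hb
      rw [sumDiff_apply ha, sumIncl_apply hb, DirectSum.of_mul_of, DirectSum.of_mul_of,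
        smul_of]
      refine of_congr (by simp [add_comm]) ?_
      rw [Submodule.coe_smul]
      exact diff_mul_incl ha hb)
    (by
      intro g h a b ha hb
      rw [sumDiff_apply ha, sumDiff_apply hb, DirectSum.of_mul_of, DirectSum.of_mul_of,
        smul_of, ← map_neg]
      refine of_congr (by simp [add_comm]) ?_
      rw [NegMemClass.coe_neg, Submodule.coe_smul]
      exact diff_mul_diff ha hb)

theorem toGraded_incl (a : A) : toGraded P 𝒜 (incl P 𝒜 a) = sumIncl P 𝒜 a :=
  lift_incl ..

theorem toGraded_diff (a : A) : toGraded P 𝒜 (diff P 𝒜 a) = sumDiff P 𝒜 a :=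
  lift_diff ..

theorem toGraded_word {i : G × ℤ} {x : Forms P 𝒜} (hx : IsWord P 𝒜 i x) :
    toGraded P 𝒜 x = DirectSum.of (fun i => grading P 𝒜 i) i ⟨x, word_mem hx⟩ := by
  induction hx with
  | one => rw [map_one, DirectSum.one_def]; exact of_congr rfl rfl
  | incl_mul ha _ ih =>
    rw [map_mul, ih, toGraded_incl, sumIncl_apply ha, DirectSum.of_mul_of]
    exact of_congr rfl rfl
  | diff_mul ha _ ih =>
    rw [map_mul, ih, toGraded_diff, sumDiff_apply ha, DirectSum.of_mul_of]
    exact of_congr rfl rfl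

instance : GradedAlgebra (grading P 𝒜) :=
  GradedAlgebra.ofAlgHom (grading P 𝒜) (toGraded P 𝒜)
    (by
      refine hom_ext (P := P) (𝒜 := 𝒜) (fun a => ?_) (fun a => ?_)
      · induction a using homogeneous_induction (𝒜 := 𝒜) with
        | h0 => simp
        | hadd a a' h h' => simp only [map_add, h, h']
        | hh g a ha =>
          rw [AlgHom.comp_apply, toGraded_incl, sumIncl_apply ha]
          simp
      · induction a using homogeneous_induction (𝒜 := 𝒜) with
        | h0 => simp
        | hadd a a' h h' => simp only [map_add, h, h']
        | hh g a ha =>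
          rw [AlgHom.comp_apply, toGraded_diff, sumDiff_apply ha]
          simp)
    (by
      rintro i ⟨x, hx⟩
      refine Submodule.span_induction
        (p := fun x hx => toGraded P 𝒜 x = DirectSum.of (fun i => grading P 𝒜 i) i ⟨x, hx⟩)
        ?_ ?_ ?_ ?_ hx
      · intro x hx; exact toGraded_word hx
      · rw [map_zero, ← map_zero (DirectSum.of (fun i => grading P 𝒜 i) i)]; rfl
      · intro x y hx hy h h'
        rw [map_add, h, h', ← map_add]; rfl
      · intro c x hx h
        rw [map_smul, h, ← DirectSum.lof_eq_of k, ← map_smul]; rfl)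

/-! ### Graded commutativity of `Λ(A)` -/

variable [GradedCommutative P 𝒜]

theorem incl_comm_word {g : G} {a : A} (ha : a ∈ 𝒜 g) {j : G × ℤ} {y : Forms P 𝒜}
    (hy : IsWord P 𝒜 j y) :
    incl P 𝒜 a * y = P.extend.sign k (g, 0) j • (y * incl P 𝒜 a) := by
  induction hy with
  | one => simp
  | @incl_mul h b j x hb _ ih =>
    rw [← mul_assoc, ← map_mul, GradedCommutative.comm (P := P) ha hb, map_smul, map_mul, smul_mul_assoc, mul_assoc, ih,
      mul_smul_comm, smul_smul, P.extend.sign_add_right, P.sign_extend_zero_right g h, mul_assoc]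
  | @diff_mul h b j x hb _ ih =>
    have : incl P 𝒜 a * diff P 𝒜 b = P.sign k g h • (diff P 𝒜 b * incl P 𝒜 a) := by
      rw [diff_mul_incl hb ha, smul_smul, P.sign_comm h g, P.sign_mul_self, one_smul]
    rw [← mul_assoc, this, smul_mul_assoc, mul_assoc, ih,
      mul_smul_comm, smul_smul, P.extend.sign_add_right, P.sign_extend_zero_left g h, mul_assoc]

theorem diff_comm_word {g : G} {a : A} (ha : a ∈ 𝒜 g) {j : G × ℤ} {y : Forms P 𝒜}
    (hy : IsWord P 𝒜 j y) :
    diff P 𝒜 a * y = P.extend.sign k (g, 1) j • (y * diff P 𝒜 a) := by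
  induction hy with
  | one => simp
  | @incl_mul h b j x hb _ ih =>
    rw [← mul_assoc, diff_mul_incl ha hb, smul_mul_assoc, mul_assoc, ih,
      mul_smul_comm, smul_smul, P.extend.sign_add_right, P.sign_extend_zero_right g h, mul_assoc]
  | @diff_mul h b j x hb _ ih =>
    rw [← mul_assoc, diff_mul_diff ha hb, ← neg_smul, smul_mul_assoc, mul_assoc, ih,
      mul_smul_comm, smul_smul, P.extend.sign_add_right, P.sign_extend_one g h, mul_assoc]

instance : GradedCommutative P.extend (grading P 𝒜) where
  comm {i j x y} hx hy := by
    refine grading_induction (p := fun x => x * y = P.extend.sign k i j • (y * x)) ?_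
      (by simp) ?_ ?_ hx
    · intro x hx
      refine grading_induction (p := fun y => x * y = P.extend.sign k i j • (y * x)) ?_
        (by simp) ?_ ?_ hy
      · intro y hy
        clear * - hx hy
        induction hx with
        | one => simp
        | incl_mul ha _ ih =>
          rw [mul_assoc, ih, mul_smul_comm, ← mul_assoc, incl_comm_word ha hy, smul_mul_assoc,
            smul_smul, P.extend.sign_add_left, mul_comm, mul_assoc]
        | diff_mul ha _ ih =>
          rw [mul_assoc, ih, mul_smul_comm, ← mul_assoc, diff_comm_word ha hy, smul_mul_assoc,
            smul_smul, P.extend.sign_add_left, mul_comm, mul_assoc]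
      · intro a b ha hb; simp only [mul_add, add_mul, smul_add, ha, hb]
      · intro c a ha; rw [mul_smul_comm, ha, smul_mul_assoc, smul_comm]
    · intro a b ha hb; simp only [mul_add, add_mul, smul_add, ha, hb]
    · intro c a ha; rw [smul_mul_assoc, ha, mul_smul_comm, smul_comm]


end

/-! ### Graded derivations of `Λ(A)` -/

section

variable [GradedAlgebra 𝒜]

variable (P 𝒜) in
/-- The map `a ↦ (-1) ^ (δ · |a|) a` of a graded algebra. -/
def signMap (δ : G) : A →ₗ[k] A :=
  (DirectSum.toModule k G A (fun g => P.sign k δ g • (𝒜 g).subtype)) ∘ₗ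
    (DirectSum.decomposeLinearEquiv 𝒜).toLinearMap

theorem signMap_apply (δ : G) {g : G} {a : A} (ha : a ∈ 𝒜 g) :
    signMap P 𝒜 δ a = P.sign k δ g • a := by
  simp only [signMap, LinearMap.comp_apply, LinearEquiv.coe_coe,
    DirectSum.decomposeLinearEquiv_apply, DirectSum.decompose_of_mem 𝒜 ha]
  rw [← DirectSum.lof_eq_of k, DirectSum.toModule_lof]
  rfl

theorem signMap_one (δ : G) : signMap P 𝒜 δ 1 = 1 := by
  rw [signMap_apply δ (SetLike.GradedOne.one_mem (A := 𝒜))]; simp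

theorem signMap_mul (δ : G) (a b : A) :
    signMap P 𝒜 δ (a * b) = signMap P 𝒜 δ a * signMap P 𝒜 δ b := by
  induction a using homogeneous_induction (𝒜 := 𝒜) with
  | h0 => simp
  | hadd a a' h h' => simp only [add_mul, map_add, h, h']
  | hh g a ha =>
  induction b using homogeneous_induction (𝒜 := 𝒜) with
  | h0 => simp
  | hadd a a' h h' => simp only [mul_add, map_add, h, h']
  | hh h b hb =>
    rw [signMap_apply δ ha, signMap_apply δ hb, signMap_apply δ (SetLike.GradedMul.mul_mem ha hb),
      smul_mul_smul_comm, P.sign_add_right]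

/-- The map `a ↦ !![τ (φ a), f a; 0, φ a]`. -/
def upper (τ : Forms P 𝒜 →ₗ[k] Forms P 𝒜) (φ f : A →ₗ[k] Forms P 𝒜) :
    A →ₗ[k] Matrix (Fin 2) (Fin 2) (Forms P 𝒜) where
  toFun a := !![τ (φ a), f a; 0, φ a]
  map_add' a b := by ext i j; fin_cases i <;> fin_cases j <;> simp
  map_smul' c a := by ext i j; fin_cases i <;> fin_cases j <;> simp

theorem upper_apply (τ : Forms P 𝒜 →ₗ[k] Forms P 𝒜) (φ f : A →ₗ[k] Forms P 𝒜) (a : A) :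
    upper τ φ f a = !![τ (φ a), f a; 0, φ a] := rfl

variable (P 𝒜) in
/-- Values `F a` on `a` and `E a` on `d a` that extend to a graded derivation of degree `δ`. -/
structure DerivationData (δ : G × ℤ) where
  F : A →ₗ[k] Forms P 𝒜
  E : A →ₗ[k] Forms P 𝒜
  F_mem : ∀ {g : G} {a : A}, a ∈ 𝒜 g → F a ∈ grading P 𝒜 ((g, 0) + δ)
  E_mem : ∀ {g : G} {a : A}, a ∈ 𝒜 g → E a ∈ grading P 𝒜 ((g, 1) + δ)
  mul : ∀ {g : G} {a : A} (b : A), a ∈ 𝒜 g → F (a * b) =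
    F a * incl P 𝒜 b + P.extend.sign k δ (g, 0) • (incl P 𝒜 a * F b)
  leib : ∀ {g : G} {a : A} (b : A), a ∈ 𝒜 g → E (a * b) =
    E a * incl P 𝒜 b + P.extend.sign k δ (g, 1) • (diff P 𝒜 a * F b)
      + (F a * diff P 𝒜 b + P.extend.sign k δ (g, 0) • (incl P 𝒜 a * E b))
  comm : ∀ {g h : G} {a b : A}, a ∈ 𝒜 g → b ∈ 𝒜 h →
    E a * incl P 𝒜 b + P.extend.sign k δ (g, 1) • (diff P 𝒜 a * F b) =
      P.sign k g h • (F b * diff P 𝒜 a + P.extend.sign k δ (h, 0) • (incl P 𝒜 b * E a))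
  comm_d : ∀ {g h : G} {a b : A}, a ∈ 𝒜 g → b ∈ 𝒜 h →
    E a * diff P 𝒜 b + P.extend.sign k δ (g, 1) • (diff P 𝒜 a * E b) =
      -(P.sign k g h • (E b * diff P 𝒜 a + P.extend.sign k δ (h, 1) • (diff P 𝒜 b * E a)))

namespace DerivationData

variable {δ : G × ℤ} (D : DerivationData P 𝒜 δ)

/-- The homomorphism `x ↦ !![τ x, D x; 0, x]`, where `τ` is the sign map of `δ`. -/
def hom : Forms P 𝒜 →ₐ[k] Matrix (Fin 2) (Fin 2) (Forms P 𝒜) :=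
  lift (P := P) (𝒜 := 𝒜) (B := Matrix (Fin 2) (Fin 2) (Forms P 𝒜))
    (upper (signMap P.extend (grading P 𝒜) δ) (incl P 𝒜).toLinearMap D.F)
    (upper (signMap P.extend (grading P 𝒜) δ) (diff P 𝒜) D.E)
    (by
      have h := D.mul 1 (SetLike.GradedOne.one_mem (A := 𝒜))
      have h0 : P.extend.sign k δ (0, 0) = 1 := P.extend.sign_zero_right δ
      rw [h0] at h
      have : D.F 1 = 0 := by simpa using h
      rw [upper_apply, this, AlgHom.toLinearMap_apply, map_one, signMap_one]
      exact Matrix.one_fin_two.symm)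
    (by
      intro a b
      induction a using homogeneous_induction (𝒜 := 𝒜) with
      | h0 => simp
      | hadd a a' h h' => simp only [add_mul, map_add, h, h']
      | hh g a ha =>
        simp only [upper_apply, Matrix.mul_fin_two, AlgHom.toLinearMap_apply, map_mul, signMap_mul,
          D.mul b ha, signMap_apply δ (incl_mem ha)]
        simp [add_comm])
    (by
      intro a b
      induction a using homogeneous_induction (𝒜 := 𝒜) with
      | h0 => simp
      | hadd a a' h h' => simp only [add_mul, map_add, h, h']; abel
      | hh g a ha =>
        simp only [upper_apply, Matrix.mul_fin_two, AlgHom.toLinearMap_apply, signMap_mul,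
          D.leib b ha, diff_mul, map_add, signMap_apply δ (incl_mem ha),
          signMap_apply δ (diff_mem ha)]
        ext i j
        fin_cases i <;> fin_cases j <;> simp
        abel)
    (by
      intro g h a b ha hb
      have := D.comm ha hb
      have h2 := diff_mul_incl (P := P) ha hb
      simp only [upper_apply, Matrix.mul_fin_two, AlgHom.toLinearMap_apply,
          signMap_apply δ (incl_mem hb), signMap_apply δ (diff_mem ha)]
      ext i j
      fin_cases i <;> fin_cases j
      · simp [h2, smul_smul, mul_comm, mul_assoc]
      · simpa [add_comm] using this
      · simp
      · simpa using h2)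
    (by
      intro g h a b ha hb
      have := D.comm_d ha hb
      have h2 := diff_mul_diff (P := P) ha hb
      simp only [upper_apply, Matrix.mul_fin_two,
          signMap_apply δ (diff_mem ha), signMap_apply δ (diff_mem hb)]
      ext i j
      fin_cases i <;> fin_cases j
      · simp [h2, smul_smul, mul_comm, mul_assoc]
      · simpa [add_comm] using this
      · simp
      · simpa using h2)

theorem hom_incl (a : A) : D.hom (incl P 𝒜 a) =
    !![signMap P.extend (grading P 𝒜) δ (incl P 𝒜 a), D.F a; 0, incl P 𝒜 a] := lift_incl ..

theorem hom_diff (a : A) : D.hom (diff P 𝒜 a) =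
    !![signMap P.extend (grading P 𝒜) δ (diff P 𝒜 a), D.E a; 0, diff P 𝒜 a] := lift_diff ..

/-- The underlying linear map of the derivation. -/
def toLinearMap : Forms P 𝒜 →ₗ[k] Forms P 𝒜 :=
  Matrix.entryLinearMap k (Forms P 𝒜) 0 1 ∘ₗ D.hom.toLinearMap

theorem toLinearMap_apply (x : Forms P 𝒜) : D.toLinearMap x = D.hom x 0 1 := rfl

theorem toLinearMap_incl (a : A) : D.toLinearMap (incl P 𝒜 a) = D.F a := by
  rw [toLinearMap_apply, hom_incl]; rfl

theorem toLinearMap_diff (a : A) : D.toLinearMap (diff P 𝒜 a) = D.E a := by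
  rw [toLinearMap_apply, hom_diff]; rfl

theorem forms_induction {p : Forms P 𝒜 → Prop} (hw : ∀ i x, IsWord P 𝒜 i x → p x)
    (h0 : p 0) (hadd : ∀ x y, p x → p y → p (x + y)) (hsmul : ∀ (c : k) x, p x → p (c • x))
    (x : Forms P 𝒜) : p x :=
  homogeneous_induction (𝒜 := grading P 𝒜) h0
    (fun i _ hx => grading_induction (hw i) h0 hadd hsmul hx) hadd x

theorem hom_eq (x : Forms P 𝒜) : D.hom x =
    !![signMap P.extend (grading P 𝒜) δ x, D.toLinearMap x; 0, x] := by
  have key : D.hom x 0 0 = signMap P.extend (grading P 𝒜) δ x ∧ D.hom x 1 0 = 0 ∧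
      D.hom x 1 1 = x := by
    induction x using forms_induction with
    | h0 => simp
    | hadd x y hx hy => simp [hx, hy]
    | hsmul c x hx => simp [hx]
    | hw i x hx =>
      induction hx with
      | one => simp [signMap_one]
      | incl_mul ha _ ih =>
        rw [map_mul, hom_incl, signMap_mul]
        simp [Matrix.mul_apply, Fin.sum_univ_two, ih]
      | diff_mul ha _ ih =>
        rw [map_mul, hom_diff, signMap_mul]
        simp [Matrix.mul_apply, Fin.sum_univ_two, ih]
  ext i j
  fin_cases i <;> fin_cases j <;> simp [key, toLinearMap_apply]

theorem toLinearMap_mul (x y : Forms P 𝒜) : D.toLinearMap (x * y) =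
    D.toLinearMap x * y + signMap P.extend (grading P 𝒜) δ x * D.toLinearMap y := by
  rw [toLinearMap_apply, map_mul, hom_eq, hom_eq]
  simp [Matrix.mul_apply, Fin.sum_univ_two, add_comm]

theorem toLinearMap_mem {i : G × ℤ} {x : Forms P 𝒜} (hx : x ∈ grading P 𝒜 i) :
    D.toLinearMap x ∈ grading P 𝒜 (i + δ) := by
  refine grading_induction (p := fun x => D.toLinearMap x ∈ grading P 𝒜 (i + δ)) ?_ (by simp)
    ?_ ?_ hx
  · clear hx x
    intro x hx
    induction hx with
    | one =>
      have h := D.toLinearMap_mul 1 1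
      rw [signMap_one] at h
      have : D.toLinearMap 1 = 0 := by simpa using h
      rw [this]; exact zero_mem _
    | incl_mul ha hw ih =>
      rw [toLinearMap_mul, toLinearMap_incl, signMap_apply δ (incl_mem ha), smul_mul_assoc]
      refine add_mem ?_ (Submodule.smul_mem _ _ ?_)
      · convert SetLike.GradedMul.mul_mem (D.F_mem ha) (word_mem hw) using 2; abel
      · convert SetLike.GradedMul.mul_mem (incl_mem (P := P) ha) ih using 2; abel
    | diff_mul ha hw ih =>
      rw [toLinearMap_mul, toLinearMap_diff, signMap_apply δ (diff_mem ha), smul_mul_assoc]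
      refine add_mem ?_ (Submodule.smul_mem _ _ ?_)
      · convert SetLike.GradedMul.mul_mem (D.E_mem ha) (word_mem hw) using 2; abel
      · convert SetLike.GradedMul.mul_mem (diff_mem (P := P) ha) ih using 2; abel
  · intro x y hx hy; rw [map_add]; exact add_mem hx hy
  · intro c x hx; rw [map_smul]; exact Submodule.smul_mem _ _ hx

/-- The graded derivation with the given values on the generators. -/
def toDerivation : GradedDerivation P.extend (grading P 𝒜) δ where
  toLinearMap := D.toLinearMap
  map_mem := D.toLinearMap_mem
  leibniz {i x} y hx := by rw [toLinearMap_mul, signMap_apply δ hx, smul_mul_assoc]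

end DerivationData

variable (P 𝒜) in
/-- The exterior differential `d : Λ(A) → Λ(A)`: the graded derivation of degree `(0, 1)` with
`a ↦ d a` and `d a ↦ 0`. -/
def d : GradedDerivation P.extend (grading P 𝒜) (0, 1) :=
  DerivationData.toDerivation
  { F := diff P 𝒜
    E := 0
    F_mem := fun ha => by simpa using diff_mem ha
    E_mem := fun _ => zero_mem _
    mul := fun {g a} b _ => by
      rw [diff_mul, P.sign_extend_zero_right, P.sign_zero_left, one_smul]
    leib := fun {g a} b _ => by
      simp [P.sign_extend_one]
    comm := fun {g h a b} ha hb => by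
      simp [P.sign_extend_one, diff_mul_diff ha hb]
    comm_d := fun _ _ => by simp }

theorem d_incl (a : A) : d P 𝒜 (incl P 𝒜 a) = diff P 𝒜 a := DerivationData.toLinearMap_incl _ a

theorem d_diff (a : A) : d P 𝒜 (diff P 𝒜 a) = 0 := DerivationData.toLinearMap_diff _ a

variable [GradedCommutative P 𝒜]

/-- The insertion operator `i_X : Λ(A) → Λ(A)`: the graded derivation of degree `(|X|, -1)` with
`a ↦ 0` and `d a ↦ X a`. -/
def insertion {δ : G} (X : GradedDerivation P 𝒜 δ) :
    GradedDerivation P.extend (grading P 𝒜) (δ, -1) :=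
  DerivationData.toDerivation
  { F := 0
    E := (incl P 𝒜).toLinearMap ∘ₗ X.toLinearMap
    F_mem := fun _ => zero_mem _
    E_mem := fun ha => by simpa using incl_mem (P := P) (X.map_mem ha)
    mul := fun {g a} b _ => by simp
    leib := fun {g a} b ha => by
      simp [X.leibniz b ha, P.sign_extend_zero_right]
    comm := fun {g h a b} ha hb => by
      have := congrArg (incl P 𝒜) (GradedCommutative.comm (P := P) (X.map_mem ha) hb)
      rw [map_mul, map_smul, map_mul] at this
      simp [P.sign_extend_zero_right, this, smul_smul, P.sign_add_left]
    comm_d := fun {g h a b} ha hb => by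
      have h1 : incl P 𝒜 (X a) * diff P 𝒜 b =
          P.sign k h (g + δ) • (diff P 𝒜 b * incl P 𝒜 (X a)) := by
        rw [diff_mul_incl hb (X.map_mem ha), smul_smul, P.sign_mul_self, one_smul]
      have h2 := diff_mul_incl (P := P) ha (X.map_mem hb)
      simp only [LinearMap.comp_apply, AlgHom.toLinearMap_apply]
      rw [h1, h2, P.sign_extend_neg_one, P.sign_extend_neg_one, P.sign_add_right,
        P.sign_add_right, P.sign_comm h g, P.sign_comm h δ, P.sign_comm g δ]
      rcases P.sign_eq_or (k := k) δ g with e₁ | e₁ <;>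
      rcases P.sign_eq_or (k := k) δ h with e₂ | e₂ <;>
      rcases P.sign_eq_or (k := k) g h with e₃ | e₃ <;>
      simp [e₁, e₂, e₃] }

theorem insertion_incl {δ : G} (X : GradedDerivation P 𝒜 δ) (a : A) :
    insertion X (incl P 𝒜 a) = 0 := DerivationData.toLinearMap_incl _ a

theorem insertion_diff {δ : G} (X : GradedDerivation P 𝒜 δ) (a : A) :
    insertion X (diff P 𝒜 a) = incl P 𝒜 (X a) := DerivationData.toLinearMap_diff _ a

/-- The Lie derivative `L_X = [i_X, d]`, which extends `X` to `Λ(A)`. -/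
def lieDerivative {δ : G} (X : GradedDerivation P 𝒜 δ) :
    GradedDerivation P.extend (grading P 𝒜) ((δ, -1) + (0, 1)) :=
  (insertion X).bracket (d P 𝒜)

end

end Forms

/-! ### Twice iterated forms -/

section Iterated

variable (P : GradingPairing G) (𝒜 : G → Submodule k A) [GradedAlgebra 𝒜]

/-- The algebra `Λ₂ = Λ(Λ(A))` of twice iterated differential forms over `A`. -/
abbrev Forms₂ : Type _ := Forms P.extend (Forms.grading P 𝒜)

/-- The homogeneous component `Λ₂^(g, p, q)`, of first form degree `p` and second form
degree `q`. -/
def grading₂ (g : G) (p q : ℤ) : Submodule k (Forms₂ P 𝒜) :=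
  Forms.grading P.extend (Forms.grading P 𝒜) ((g, p), q)

/-- The inclusion `A ⊂ Λ(A) ⊂ Λ₂`. -/
def incl₂ : A →ₐ[k] Forms₂ P 𝒜 :=
  (Forms.incl P.extend (Forms.grading P 𝒜)).comp (Forms.incl P 𝒜)

/-- The first differential `d₁` of `Λ₂`: the exterior differential of `Λ(A)`, extended to
`Λ₂ = Λ(Λ(A))` as its Lie derivative. -/
def d₁ [GradedCommutative P 𝒜] : Forms₂ P 𝒜 →ₗ[k] Forms₂ P 𝒜 :=
  (Forms.lieDerivative (Forms.d P 𝒜)).toLinearMap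

/-- The second differential `d₂` of `Λ₂`: the exterior differential of `Λ₂ = Λ(Λ(A))`. -/
def d₂ : Forms₂ P 𝒜 →ₗ[k] Forms₂ P 𝒜 :=
  (Forms.d P.extend (Forms.grading P 𝒜)).toLinearMap

/-- Two endomorphisms of a module with homogeneous components `V^(g, p, q)` form a double complex:
they raise `p`, respectively `q`, by one, have square zero, and commute. -/
structure IsDoubleComplex {M : Type*} [AddCommGroup M] [Module k M]
    (V : G → ℤ → ℤ → Submodule k M) (δ₁ δ₂ : M →ₗ[k] M) : Prop where
  mem₁ : ∀ g p q, ∀ ω ∈ V g p q, δ₁ ω ∈ V g (p + 1) q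
  mem₂ : ∀ g p q, ∀ ω ∈ V g p q, δ₂ ω ∈ V g p (q + 1)
  sq₁ : ∀ ω, δ₁ (δ₁ ω) = 0
  sq₂ : ∀ ω, δ₂ (δ₂ ω) = 0
  comm : ∀ ω, δ₁ (δ₂ ω) = δ₂ (δ₁ ω)

end Iterated

end IteratedForms

open IteratedForms

namespace IteratedForms

set_option linter.unusedSectionVars false

variable {k : Type*} [Field k] {G : Type*} [AddCommGroup G] [DecidableEq G]
  {A : Type*} [Ring A] [Algebra k A]

/-! An algebra homomorphism out of `Forms` is the same as an algebra homomorphism `f` on the base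
together with a derivation `e` along `f` whose values satisfy the graded commutation rules. Applying
this twice builds `κ`. On `Λ(A)`, `inclSecond` keeps `a` and sends `da` to `d₂ a`. On `Λ₂ =
Λ(Λ(A))`, `flip` sends `x` to `inclSecond x` and `d₂ x` to `d₁ (inclSecond x)`. The commutation
rules required at each stage are instances of the graded commutativity of `Λ₂`: by
`sign_extend_extend` its signs do not change when the two form degrees are exchanged in both
arguments.

The identities `κ d₁ = d₂ κ` and `κ d₂ = d₁ κ` compare maps that obey the same Leibniz rule along
`κ`, so `intertwines` reduces them to generators, where they follow from `d₁ d₂ = d₂ d₁` and `d₁² =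
d₂² = 0`. Finally `κ ∘ κ` fixes `A` and commutes with both differentials. Since `A`, `d₁` and `d₂`
generate `Λ₂`, it is the identity. The formulas on products follow from multiplicativity.

The double complex itself comes from Cartan's formula `L_X = i_X d + d i_X`, which gives `L_X d = d
L_X` and shows that `L_X` acts as `X` on `Λ(A)` and on its differentials. -/

theorem GradedDerivation.map_one {P : GradingPairing G} {𝒜 : G → Submodule k A}
    [SetLike.GradedMonoid 𝒜] {δ : G} (D : GradedDerivation P 𝒜 δ) : D 1 = 0 := by
  have h := D.leibniz 1 (SetLike.GradedOne.one_mem (A := 𝒜))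
  simpa using h

/-! ### Homomorphisms and derivations of `Λ(A)` are controlled by generators. -/

namespace Forms

variable {P : GradingPairing G} {𝒜 : G → Submodule k A}

/-- An algebra homomorphism is compatible with the gradings as soon as it is so on the
generators. -/
theorem map_mem_of_generators {B : Type*} [Ring B] [Algebra k B] {H : Type*} [AddCommGroup H]
    {ℬ : H → Submodule k B} [SetLike.GradedMonoid ℬ] (φ : Forms P 𝒜 →ₐ[k] B) (σ : G × ℤ → H)
    (hzero : σ 0 = 0) (hadd : ∀ i j, σ (i + j) = σ i + σ j)
    (hincl : ∀ g, ∀ a ∈ 𝒜 g, φ (incl P 𝒜 a) ∈ ℬ (σ (g, 0)))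
    (hdiff : ∀ g, ∀ a ∈ 𝒜 g, φ (diff P 𝒜 a) ∈ ℬ (σ (g, 1)))
    {i : G × ℤ} {x : Forms P 𝒜} (hx : x ∈ grading P 𝒜 i) : φ x ∈ ℬ (σ i) := by
  refine grading_induction (p := fun x => φ x ∈ ℬ (σ i)) (fun x hx => ?_) (by simp)
    (fun x y hx hy => by rw [map_add]; exact add_mem hx hy)
    (fun c x hx => by rw [map_smul]; exact Submodule.smul_mem _ _ hx) hx
  clear * - hx hincl hdiff hzero hadd
  induction hx with
  | one => rw [map_one, hzero]; exact SetLike.GradedOne.one_mem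
  | incl_mul ha _ ih =>
    rw [map_mul, hadd]; exact SetLike.GradedMul.mul_mem (hincl _ _ ha) ih
  | diff_mul ha _ ih =>
    rw [map_mul, hadd]; exact SetLike.GradedMul.mul_mem (hdiff _ _ ha) ih

variable [GradedAlgebra 𝒜]

/-- An algebra homomorphism intertwines two graded derivations as soon as it does so on the
generators. -/
theorem intertwines {B : Type*} [Ring B] [Algebra k B] {H : Type*} [AddCommGroup H]
    [DecidableEq H] {Q : GradingPairing H} {ℬ : H → Submodule k B} [SetLike.GradedMonoid ℬ]
    {δ : G × ℤ} {ε : H} (D : GradedDerivation P.extend (grading P 𝒜) δ)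
    (E : GradedDerivation Q ℬ ε) (φ : Forms P 𝒜 →ₐ[k] B) (σ : G × ℤ → H)
    (hφ : ∀ i, ∀ x ∈ grading P 𝒜 i, φ x ∈ ℬ (σ i))
    (hsign : ∀ i, P.extend.sign k δ i = Q.sign k ε (σ i))
    (hincl : ∀ a, φ (D (incl P 𝒜 a)) = E (φ (incl P 𝒜 a)))
    (hdiff : ∀ a, φ (D (diff P 𝒜 a)) = E (φ (diff P 𝒜 a))) (x : Forms P 𝒜) :
    φ (D x) = E (φ x) := by
  induction x using DerivationData.forms_induction with
  | h0 => simp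
  | hadd x y hx hy => simp only [map_add, hx, hy]
  | hsmul c x hx => simp only [map_smul, hx]
  | hw i x hx =>
    induction hx with
    | one => rw [D.map_one, map_one, map_zero, E.map_one]
    | incl_mul ha _ ih =>
      -- Both composites obey the same Leibniz rule along `φ`: `hφ` supplies the homogeneity that
      -- `E.leibniz` needs, and `hsign` identifies the two signs.
      rw [D.leibniz _ (incl_mem ha), map_mul, E.leibniz _ (hφ _ _ (incl_mem ha)), map_add,
        map_smul, map_mul, map_mul, ih, hincl, hsign]
    | diff_mul ha _ ih =>
      rw [D.leibniz _ (diff_mem ha), map_mul, E.leibniz _ (hφ _ _ (diff_mem ha)), map_add,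
        map_smul, map_mul, map_mul, ih, hdiff, hsign]

/-- An odd graded derivation has square zero as soon as it does so on the generators. -/
theorem sq_eq_zero {δ : G × ℤ} (D : GradedDerivation P.extend (grading P 𝒜) δ)
    (hδ : P.extend.sign k δ δ = -1) (hincl : ∀ a, D (D (incl P 𝒜 a)) = 0)
    (hdiff : ∀ a, D (D (diff P 𝒜 a)) = 0) (x : Forms P 𝒜) : D (D x) = 0 := by
  have key : ∀ {i : G × ℤ} {x : Forms P 𝒜} (y : Forms P 𝒜), x ∈ grading P 𝒜 i →
      D (D x) = 0 → D (D y) = 0 → D (D (x * y)) = 0 := by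
    intro i x y hx h h'
    -- The two cross terms `D x * D y` carry the signs of `(δ, i + δ)` and `(δ, i)`, which are
    -- opposite by `hδ`, so they cancel.
    rw [D.leibniz y hx, map_add, map_smul, D.leibniz _ (D.map_mem hx), D.leibniz _ hx, h, h',
      P.extend.sign_add_right, hδ]
    simp
  induction x using DerivationData.forms_induction with
  | h0 => simp
  | hadd x y hx hy => simp only [map_add, hx, hy, add_zero]
  | hsmul c x hx => simp only [map_smul, hx, smul_zero]
  | hw i x hx =>
    induction hx with
    | one => rw [D.map_one, map_zero]
    | incl_mul ha _ ih => exact key _ (incl_mem ha) (hincl _) ih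
    | diff_mul ha _ ih => exact key _ (diff_mem ha) (hdiff _) ih

theorem d_d (x : Forms P 𝒜) : d P 𝒜 (d P 𝒜 x) = 0 :=
  sq_eq_zero _ (by rw [P.sign_extend_one, P.sign_zero_left])
    (fun a => by rw [d_incl, d_diff]) (fun a => by rw [d_diff, map_zero]) x

/-! ### Cartan calculus for the Lie derivative. -/

section

variable [GradedCommutative P 𝒜] {δ : G} (X : GradedDerivation P 𝒜 δ)

/-- The degrees `(δ, -1)` and `(0, 1)` pair to `1`, so the graded commutator is an anticommutator.
-/
theorem lieDerivative_apply (x : Forms P 𝒜) :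
    lieDerivative X x = insertion X (d P 𝒜 x) + d P 𝒜 (insertion X x) := by
  change insertion X (d P 𝒜 x) - P.extend.sign k (δ, -1) (0, 1) • d P 𝒜 (insertion X x) = _
  rw [P.sign_extend_neg_one, P.sign_zero_right, neg_one_smul, sub_neg_eq_add]

theorem lieDerivative_incl (a : A) : lieDerivative X (incl P 𝒜 a) = incl P 𝒜 (X a) := by
  rw [lieDerivative_apply, d_incl, insertion_diff, insertion_incl, map_zero, add_zero]

theorem lieDerivative_diff (a : A) : lieDerivative X (diff P 𝒜 a) = diff P 𝒜 (X a) := by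
  rw [lieDerivative_apply, d_diff, insertion_diff, map_zero, zero_add, d_incl]

/-- By Cartan's formula and `d² = 0`, both sides reduce to `d i_X d`. Taken for `X = d` one level
down, this is the commutation of `d₁` and `d₂`. -/
theorem lieDerivative_d (x : Forms P 𝒜) :
    lieDerivative X (d P 𝒜 x) = d P 𝒜 (lieDerivative X x) := by
  simp only [lieDerivative_apply, d_d, map_zero, map_add, zero_add, add_zero]

end

end Forms

/-! ### The double complex structure on `Λ₂`. -/

section Iterated

open Forms

variable {P : GradingPairing G} {𝒜 : G → Submodule k A} [GradedAlgebra 𝒜]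

theorem d₂_incl (x : Forms P 𝒜) :
    d₂ P 𝒜 (incl P.extend (grading P 𝒜) x) = diff P.extend (grading P 𝒜) x := d_incl x

theorem d₂_d₂ (ω : Forms₂ P 𝒜) : d₂ P 𝒜 (d₂ P 𝒜 ω) = 0 := d_d ω

theorem d₂_mem {g : G} {p q : ℤ} {ω : Forms₂ P 𝒜} (h : ω ∈ grading₂ P 𝒜 g p q) :
    d₂ P 𝒜 ω ∈ grading₂ P 𝒜 g p (q + 1) := by
  have h' := (d P.extend (grading P 𝒜)).map_mem h
  rw [Prod.mk_add_mk, add_zero] at h'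
  exact h'

/-- The two form degrees enter through separate, identical factors, so exchanging them in both
arguments preserves the sign. This symmetry is what makes an exchange of `d₁` and `d₂` compatible
with the defining relations. -/
theorem sign_extend_extend (g h : G) (p q p' q' : ℤ) :
    P.extend.extend.sign k ((g, p), q) ((h, p'), q') =
      P.sign k g h * ((((-1 : ℤˣ) ^ (((p * p' : ℤ)) : ZMod 2) : ℤˣ) : ℤ) *
        (((-1 : ℤˣ) ^ (((q * q' : ℤ)) : ZMod 2) : ℤˣ) : ℤ)) := by
  rw [GradingPairing.sign_extend, GradingPairing.sign_extend, mul_assoc]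

theorem incl₂_mem {g : G} {a : A} (ha : a ∈ 𝒜 g) : incl₂ P 𝒜 a ∈ grading₂ P 𝒜 g 0 0 :=
  incl_mem (incl_mem ha)

theorem d₂_incl₂_mul (a b : A) : d₂ P 𝒜 (incl₂ P 𝒜 (a * b)) =
    d₂ P 𝒜 (incl₂ P 𝒜 a) * incl₂ P 𝒜 b + incl₂ P 𝒜 a * d₂ P 𝒜 (incl₂ P 𝒜 b) := by
  simp only [incl₂, AlgHom.comp_apply, d₂_incl, _root_.map_mul (incl P 𝒜),
    diff_mul P.extend (grading P 𝒜)]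

variable [GradedCommutative P 𝒜]

theorem grading₂_comm {g h : G} {p q p' q' : ℤ} {x y : Forms₂ P 𝒜}
    (hx : x ∈ grading₂ P 𝒜 g p q) (hy : y ∈ grading₂ P 𝒜 h p' q') :
    x * y = P.extend.extend.sign k ((g, p), q) ((h, p'), q') • (y * x) :=
  GradedCommutative.comm (P := P.extend.extend) hx hy

theorem d₁_incl (x : Forms P 𝒜) : d₁ P 𝒜 (incl P.extend (grading P 𝒜) x) =
    incl P.extend (grading P 𝒜) (d P 𝒜 x) := lieDerivative_incl _ x

theorem d₁_d₂ (ω : Forms₂ P 𝒜) : d₁ P 𝒜 (d₂ P 𝒜 ω) = d₂ P 𝒜 (d₁ P 𝒜 ω) :=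
  lieDerivative_d _ ω

theorem d₁_mem {g : G} {p q : ℤ} {ω : Forms₂ P 𝒜} (h : ω ∈ grading₂ P 𝒜 g p q) :
    d₁ P 𝒜 ω ∈ grading₂ P 𝒜 g (p + 1) q := by
  have h' := (lieDerivative (d P 𝒜)).map_mem h
  simp only [Prod.mk_add_mk, add_zero, neg_add_cancel] at h'
  exact h'

theorem d₁_d₁ (ω : Forms₂ P 𝒜) : d₁ P 𝒜 (d₁ P 𝒜 ω) = 0 :=
  -- The degree `((0, 1), -1) + (0, 1)` of `d₁` is `((0, 1), 0)`, which pairs with itself to `1`, so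
  -- `d₁` is odd. On the generators `x` and `d₂ x` with `x` in `Λ(A)`, it acts through `d x`.
  sq_eq_zero (lieDerivative (d P 𝒜)) (by simp [sign_extend_extend])
    (fun a => by rw [lieDerivative_incl, lieDerivative_incl, d_d, map_zero])
    (fun a => by rw [lieDerivative_diff, lieDerivative_diff, d_d, map_zero]) ω

theorem isDoubleComplex_forms₂ : IsDoubleComplex (grading₂ P 𝒜) (d₁ P 𝒜) (d₂ P 𝒜) where
  mem₁ _ _ _ _ h := d₁_mem h
  mem₂ _ _ _ _ h := d₂_mem h
  sq₁ := d₁_d₁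
  sq₂ := d₂_d₂
  comm := d₁_d₂

theorem d₁_mul {g : G} {p q : ℤ} {x : Forms₂ P 𝒜} (hx : x ∈ grading₂ P 𝒜 g p q)
    (y : Forms₂ P 𝒜) : d₁ P 𝒜 (x * y) =
      d₁ P 𝒜 x * y + P.extend.extend.sign k ((0, 1), 0) ((g, p), q) • (x * d₁ P 𝒜 y) := by
  have h := (lieDerivative (d P 𝒜)).leibniz y hx
  simp only [Prod.mk_add_mk, add_zero, neg_add_cancel] at h
  exact h

/-! ### The second copy of `Λ(A)` inside `Λ₂`. -/

variable (P 𝒜) in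
/-- The homomorphism `Λ(A) → Λ₂` that is the identity on `A` and sends `d a` to `d₂ a`. -/
def inclSecond : Forms P 𝒜 →ₐ[k] Forms₂ P 𝒜 :=
  lift (P := P) (incl₂ P 𝒜).toLinearMap (d₂ P 𝒜 ∘ₗ (incl₂ P 𝒜).toLinearMap)
    (map_one (incl₂ P 𝒜)) (map_mul (incl₂ P 𝒜)) d₂_incl₂_mul
    (fun g h a b ha hb => by
      have := grading₂_comm (d₂_mem (incl₂_mem (P := P) ha)) (incl₂_mem (P := P) hb)
      simpa [sign_extend_extend] using this)
    (fun g h a b ha hb => by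
      have := grading₂_comm (d₂_mem (incl₂_mem (P := P) ha)) (d₂_mem (incl₂_mem (P := P) hb))
      simpa [sign_extend_extend] using this)

theorem inclSecond_incl (a : A) : inclSecond P 𝒜 (incl P 𝒜 a) = incl₂ P 𝒜 a := lift_incl ..

theorem inclSecond_diff (a : A) : inclSecond P 𝒜 (diff P 𝒜 a) = d₂ P 𝒜 (incl₂ P 𝒜 a) :=
  lift_diff ..

/-- The form degree moves to the second slot and the first becomes `0`. The vanishing first degree
makes `d₁` an unsigned derivation on the image, as the construction of `flip` requires. -/
theorem inclSecond_mem {g : G} {p : ℤ} {x : Forms P 𝒜} (hx : x ∈ grading P 𝒜 (g, p)) :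
    inclSecond P 𝒜 x ∈ grading₂ P 𝒜 g 0 p := by
  have hadd : ∀ i j : G × ℤ, (((i + j).1, (0 : ℤ)), (i + j).2) =
      ((i.1, (0 : ℤ)), i.2) + ((j.1, (0 : ℤ)), j.2) := fun _ _ => by simp
  have hincl : ∀ g, ∀ a ∈ 𝒜 g, inclSecond P 𝒜 (incl P 𝒜 a) ∈ grading₂ P 𝒜 g 0 0 :=
    fun g a ha => by rw [inclSecond_incl]; exact incl₂_mem ha
  have hdiff : ∀ g, ∀ a ∈ 𝒜 g, inclSecond P 𝒜 (diff P 𝒜 a) ∈ grading₂ P 𝒜 g 0 1 :=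
    fun g a ha => by rw [inclSecond_diff]; simpa using d₂_mem (incl₂_mem (P := P) ha)
  have hmem := map_mem_of_generators (ℬ := grading P.extend (grading P 𝒜)) (inclSecond P 𝒜)
    (fun i => ((i.1, 0), i.2)) rfl hadd hincl hdiff hx
  exact hmem

theorem inclSecond_d (x : Forms P 𝒜) :
    inclSecond P 𝒜 (d P 𝒜 x) = d₂ P 𝒜 (inclSecond P 𝒜 x) :=
  intertwines (d P 𝒜) (d P.extend (grading P 𝒜)) (inclSecond P 𝒜) (fun i => ((i.1, 0), i.2))
    (fun _ _ h => inclSecond_mem h)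
    (fun i => by simp [GradingPairing.sign_extend])
    (fun a => by rw [d_incl, inclSecond_diff, inclSecond_incl]; rfl)
    -- On `da` the identity says that `d₂² = 0`.
    (fun a => by rw [d_diff, inclSecond_diff, map_zero]; exact (d₂_d₂ _).symm) x

/-! ### The exchange of the two differentials. -/

variable (P 𝒜) in
/-- The endomorphism of `Λ₂` that is the identity on `A` and exchanges `d₁` and `d₂`. -/
def flip : Forms₂ P 𝒜 →ₐ[k] Forms₂ P 𝒜 :=
  lift (P := P.extend) (inclSecond P 𝒜).toLinearMap (d₁ P 𝒜 ∘ₗ (inclSecond P 𝒜).toLinearMap)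
    (map_one (inclSecond P 𝒜)) (map_mul (inclSecond P 𝒜))
    (fun a b => by
      induction a using homogeneous_induction (𝒜 := grading P 𝒜) with
      | h0 => simp
      | hadd a a' h h' => simp only [add_mul, map_add, h, h']; abel
      | hh g a ha =>
        -- The sign in `d₁_mul` is `1`, because `inclSecond P 𝒜 a` has first form degree `0`.
        have := d₁_mul (inclSecond_mem ha) (inclSecond P 𝒜 b)
        simpa [sign_extend_extend] using this)
    (fun g h a b ha hb => by
      -- The first form degrees are `1` and `0` and contribute nothing; the second ones are the form
      -- degrees of `a` and `b` in `Λ(A)`, so the sign is that of `P.extend`.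
      have := grading₂_comm (d₁_mem (inclSecond_mem ha)) (inclSecond_mem hb)
      simpa [sign_extend_extend, GradingPairing.sign_extend] using this)
    (fun g h a b ha hb => by
      -- Now both first form degrees are `1`, which produces the extra minus sign.
      have := grading₂_comm (d₁_mem (inclSecond_mem ha)) (d₁_mem (inclSecond_mem hb))
      simpa [sign_extend_extend, GradingPairing.sign_extend] using this)

theorem flip_incl (x : Forms P 𝒜) :
    flip P 𝒜 (incl P.extend (grading P 𝒜) x) = inclSecond P 𝒜 x := lift_incl ..

theorem flip_diff (x : Forms P 𝒜) :
    flip P 𝒜 (diff P.extend (grading P 𝒜) x) = d₁ P 𝒜 (inclSecond P 𝒜 x) := lift_diff ..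

theorem flip_incl₂ (a : A) : flip P 𝒜 (incl₂ P 𝒜 a) = incl₂ P 𝒜 a :=
  (flip_incl _).trans (inclSecond_incl a)

theorem flip_mem {g : G} {p q : ℤ} {ω : Forms₂ P 𝒜} (h : ω ∈ grading₂ P 𝒜 g p q) :
    flip P 𝒜 ω ∈ grading₂ P 𝒜 g q p := by
  have hincl : ∀ i, ∀ x ∈ grading P 𝒜 i,
      flip P 𝒜 (incl P.extend (grading P 𝒜) x) ∈ grading₂ P 𝒜 i.1 0 i.2 :=
    fun i x hx => by rw [flip_incl]; exact inclSecond_mem hx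
  have hdiff : ∀ i, ∀ x ∈ grading P 𝒜 i,
      flip P 𝒜 (diff P.extend (grading P 𝒜) x) ∈ grading₂ P 𝒜 i.1 1 i.2 :=
    fun i x hx => by rw [flip_diff]; simpa using d₁_mem (inclSecond_mem hx)
  have hmem := map_mem_of_generators (ℬ := grading P.extend (grading P 𝒜)) (flip P 𝒜)
    -- With `i = ((g, p), q)` this is the exchange of `p` and `q`.
    (fun i => ((i.1.1, i.2), i.1.2)) rfl (fun _ _ => rfl) hincl hdiff h
  exact hmem

theorem flip_d₂ (ω : Forms₂ P 𝒜) : flip P 𝒜 (d₂ P 𝒜 ω) = d₁ P 𝒜 (flip P 𝒜 ω) :=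
  intertwines (d P.extend (grading P 𝒜)) (lieDerivative (d P 𝒜)) (flip P 𝒜)
    (fun i => ((i.1.1, i.2), i.1.2)) (fun _ _ h => flip_mem h)
    (fun i => by simp [GradingPairing.sign_extend])
    (fun a => by rw [d_incl, flip_diff, flip_incl]; rfl)
    (fun a => by rw [d_diff, flip_diff, map_zero]; exact (d₁_d₁ _).symm) ω

theorem flip_d₁ (ω : Forms₂ P 𝒜) : flip P 𝒜 (d₁ P 𝒜 ω) = d₂ P 𝒜 (flip P 𝒜 ω) :=
  intertwines (lieDerivative (d P 𝒜)) (d P.extend (grading P 𝒜)) (flip P 𝒜)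
    (fun i => ((i.1.1, i.2), i.1.2)) (fun _ _ h => flip_mem h)
    (fun i => by simp [GradingPairing.sign_extend])
    (fun a => by rw [lieDerivative_incl, flip_incl, flip_incl]; exact inclSecond_d a)
    (fun a => by
      -- On a generator `d₂ x` both sides are mixed second differentials of `inclSecond x`, in
      -- opposite orders.
      rw [lieDerivative_diff, flip_diff, flip_diff, inclSecond_d, d₁_d₂]; rfl) ω

/-- Two uses of `hom_ext`, one for each level of forms, reduce the claim to `A`, which `flip` fixes.
Each differential is carried past both copies of `flip` and returns to itself. -/
theorem flip_comp_flip : (flip P 𝒜).comp (flip P 𝒜) = AlgHom.id k (Forms₂ P 𝒜) := by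
  have key : ((flip P 𝒜).comp (flip P 𝒜)).comp (incl P.extend (grading P 𝒜)) =
      incl P.extend (grading P 𝒜) := by
    refine hom_ext (fun a => ?_) (fun a => ?_)
    · exact (congrArg (flip P 𝒜) (flip_incl₂ a)).trans (flip_incl₂ a)
    -- Inside `Λ₂` the form `da` of `Λ(A)` is `d₁ a`, so the intertwining relations apply to it.
    · rw [AlgHom.comp_apply, AlgHom.comp_apply, ← d_incl, ← d₁_incl, flip_d₁, flip_d₂]
      exact congrArg (d₁ P 𝒜) ((congrArg (flip P 𝒜) (flip_incl₂ a)).trans (flip_incl₂ a))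
  refine hom_ext (fun x => DFunLike.congr_fun key x) (fun x => ?_)
  rw [AlgHom.comp_apply, ← d₂_incl, flip_d₂, flip_d₁]
  exact congrArg (d₂ P 𝒜) (DFunLike.congr_fun key x)

variable (P 𝒜) in
/-- The involution of `Λ₂` that is the identity on `A` and exchanges `d₁` and `d₂`. -/
def flipEquiv : Forms₂ P 𝒜 ≃ₐ[k] Forms₂ P 𝒜 :=
  AlgEquiv.ofAlgHom (flip P 𝒜) (flip P 𝒜) flip_comp_flip flip_comp_flip

theorem flipEquiv_d₁ (ω : Forms₂ P 𝒜) :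
    flipEquiv P 𝒜 (d₁ P 𝒜 ω) = d₂ P 𝒜 (flipEquiv P 𝒜 ω) := flip_d₁ ω

theorem flipEquiv_d₂ (ω : Forms₂ P 𝒜) :
    flipEquiv P 𝒜 (d₂ P 𝒜 ω) = d₁ P 𝒜 (flipEquiv P 𝒜 ω) := flip_d₂ ω

theorem flipEquiv_incl₂ (a : A) : flipEquiv P 𝒜 (incl₂ P 𝒜 a) = incl₂ P 𝒜 a := flip_incl₂ a

end Iterated

end IteratedForms

theorem mainTheorem4 {k : Type*} [Field k] [CharZero k] {G : Type*} [AddCommGroup G]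
    [DecidableEq G] {A : Type*} [Ring A] [Algebra k A] (P : GradingPairing G)
    (𝒜 : G → Submodule k A) [GradedAlgebra 𝒜] [GradedCommutative P 𝒜] :
    IsDoubleComplex (grading₂ P 𝒜) (d₁ P 𝒜) (d₂ P 𝒜) ∧
    ∃ κ : Forms₂ P 𝒜 ≃ₐ[k] Forms₂ P 𝒜,
      (∀ ω, κ (d₁ P 𝒜 ω) = d₂ P 𝒜 (κ ω)) ∧
      (∀ ω, κ (d₂ P 𝒜 ω) = d₁ P 𝒜 (κ ω)) ∧
      (∀ (g : G) (p q : ℤ), ∀ ω ∈ grading₂ P 𝒜 g p q, κ ω ∈ grading₂ P 𝒜 g q p) ∧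
      (∀ ω, κ (κ ω) = ω) ∧
      (∀ a : A, κ (incl₂ P 𝒜 a) = incl₂ P 𝒜 a) ∧
      (∀ g : A, κ (d₁ P 𝒜 (incl₂ P 𝒜 g)) = d₂ P 𝒜 (incl₂ P 𝒜 g)) ∧
      (∀ g : A, κ (d₂ P 𝒜 (incl₂ P 𝒜 g)) = d₁ P 𝒜 (incl₂ P 𝒜 g)) ∧
      (∀ l : A, κ (d₁ P 𝒜 (d₂ P 𝒜 (incl₂ P 𝒜 l))) = d₁ P 𝒜 (d₂ P 𝒜 (incl₂ P 𝒜 l))) ∧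
      (∀ gs hs ls : List A,
        κ ((gs.map fun g => d₁ P 𝒜 (incl₂ P 𝒜 g)).prod *
            (hs.map fun h => d₂ P 𝒜 (incl₂ P 𝒜 h)).prod *
            (ls.map fun l => d₁ P 𝒜 (d₂ P 𝒜 (incl₂ P 𝒜 l))).prod) =
          (gs.map fun g => d₂ P 𝒜 (incl₂ P 𝒜 g)).prod *
            (hs.map fun h => d₁ P 𝒜 (incl₂ P 𝒜 h)).prod *
            (ls.map fun l => d₁ P 𝒜 (d₂ P 𝒜 (incl₂ P 𝒜 l))).prod) := by
  refine ⟨isDoubleComplex_forms₂, flipEquiv P 𝒜, flipEquiv_d₁, flipEquiv_d₂,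
    fun _ _ _ _ h => flip_mem h, fun ω => DFunLike.congr_fun flip_comp_flip ω, flipEquiv_incl₂,
    fun g => ?_, fun g => ?_, fun l => ?_, fun gs hs ls => ?_⟩
  · rw [flipEquiv_d₁, flipEquiv_incl₂]
  · rw [flipEquiv_d₂, flipEquiv_incl₂]
  · rw [flipEquiv_d₁, flipEquiv_d₂, flipEquiv_incl₂, d₁_d₂]
  -- Here `d₁_d₂` brings the mixed differentials on both sides to the common form `d₂ d₁`.
  · simp only [map_mul, map_list_prod, List.map_map, Function.comp_def, flipEquiv_d₁,
      flipEquiv_d₂, flipEquiv_incl₂, d₁_d₂]
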